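/- Let $X$ be a real Banach space with topological dual $X^*$, and let $T:X\rightrightarrows X^*$ be a set-valued map (its values may be empty). For $A\subseteq X$ the algebraic interior of $A$ is $$\operatorname{cor}A=\{y\in A:\ \forall x\in X\ \exists \lambda>0\ \forall t\in[0,\lambda)\ \ y+tx\in A\}.$$ Infima and suprema below are taken in $[-\infty,+\infty]$, with $\inf\emptyset=+\infty$ and $\sup\emptyset=-\infty$. The map $T$ is called *quasimonotone on $K$* if for all $x,y\in K$: whenever $\langle x^*,y-x\rangle>0$ for some $x^*\in T(x)$, then $\langle y^*,y-x\rangle\ge 0$ for all $y^*\in T(y)$. A set-valued map $\Phi:V\rightrightarrows X^*$ on a convex set $V\subseteq X$ is called *upper sign-continuous* if for all $x,y\in V$ $$\Bigl(\forall t\in(0,1)\ \inf_{z^*\in\Phi(tx+(1-t)y)}\langle z^*,y-x\rangle\ge 0\Bigr)\ \Longrightarrow\ \sup_{x^*\in\Phi(x)}\langle x^*,y-x\rangle\ge 0 .$$ The map $T$ is called *locally upper sign-continuous at $x$* if there are a convex (norm) neighbourhood $V$ of $x$ and an upper sign-continuous map $\Phi:V\rightrightarrows X^*$ with nonempty convex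 weak$^*$-compact values such that $\Phi(u)\subseteq T(u)\setminus\{0\}$ for all $u\in V$. **Theorem.** Let $K$ and $U$ be nonempty convex subsets of $X$ such that $K\cap\operatorname{cor}U$ is nonempty and weakly compact. Let $T$ be quasimonotone on $K$ and locally upper sign-continuous at every point of $K$. Then the variational inequality (VI) has a solution: there is $\bar x\in K$ such that $$\sup_{x^*\in T(\bar x)}\langle x^*,y-\bar x\rangle\ge 0\qquad\text{for all } y\in K .$$ -/

import Mathlib

open scoped Topology

noncomputable section

namespace VarIneq

variable {X : Type*} [NormedAddCommGroup X] [NormedSpace ℝ X]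

/-- The algebraic interior (core) of a set. -/
def cor (A : Set X) : Set X :=
  {y | y ∈ A ∧ ∀ x : X, ∃ l : ℝ, 0 < l ∧ ∀ t ∈ Set.Ico (0 : ℝ) l, y + t • x ∈ A}

/-- Weak compactness: compactness in the topology `σ(X, X*)`. -/
def IsWeaklyCompact (A : Set X) : Prop :=
  IsCompact (toWeakSpace ℝ X '' A)

/-- Weak-star compactness: compactness in the topology `σ(X*, X)`. -/
def IsWeakStarCompact (A : Set (StrongDual ℝ X)) : Prop :=
  IsCompact (StrongDual.toWeakDual '' A)

/-- `T` is quasimonotone on `K`: for all `x, y ∈ K`, if some `x* ∈ T x` has `⟨x*, y - x⟩ > 0`,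
then every `y* ∈ T y` has `⟨y*, y - x⟩ ≥ 0`. -/
def QuasimonotoneOn (T : X → Set (StrongDual ℝ X)) (K : Set X) : Prop :=
  ∀ x ∈ K, ∀ y ∈ K, (∃ xs ∈ T x, 0 < xs (y - x)) → ∀ ys ∈ T y, 0 ≤ ys (y - x)

/-- `Φ` is upper sign-continuous on the (convex) set `U`. Infima and suprema are taken in the
extended reals, so that `inf ∅ = +∞` and `sup ∅ = -∞`. -/
def UpperSignContinuousOn (Φ : X → Set (StrongDual ℝ X)) (U : Set X) : Prop :=
  ∀ x ∈ U, ∀ y ∈ U,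
    (∀ t ∈ Set.Ioo (0 : ℝ) 1,
      (0 : EReal) ≤ ⨅ zs ∈ Φ (t • x + (1 - t) • y), ((zs (y - x) : ℝ) : EReal)) →
    (0 : EReal) ≤ ⨆ xs ∈ Φ x, ((xs (y - x) : ℝ) : EReal)

/-- `T` is locally upper sign-continuous at `x`: on some convex neighbourhood `U` of `x` there is
an upper sign-continuous submap `Φ` of `T \ {0}` with nonempty convex weak-star compact values.
Only the values of `Φ` on `U` matter. -/
def LocallyUpperSignContinuousAt (T : X → Set (StrongDual ℝ X)) (x : X) : Prop :=
  ∃ U ∈ 𝓝 x, Convex ℝ U ∧ ∃ Φ : X → Set (StrongDual ℝ X),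
    UpperSignContinuousOn Φ U ∧
    ∀ u ∈ U, (Φ u).Nonempty ∧ Convex ℝ (Φ u) ∧ IsWeakStarCompact (Φ u) ∧ Φ u ⊆ T u \ {0}

/-- `x` solves the variational inequality (VI) for `T` on `K`: `x ∈ K` and
`sup_{x* ∈ T x} ⟨x*, y - x⟩ ≥ 0` for all `y ∈ K` (supremum in the extended reals). -/
def IsSolutionVI (T : X → Set (StrongDual ℝ X)) (K : Set X) (x : X) : Prop :=
  x ∈ K ∧ ∀ y ∈ K, (0 : EReal) ≤ ⨆ xs ∈ T x, ((xs (y - x) : ℝ) : EReal)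

end VarIneq

end

/-! `K ∩ cor U` is closed, and along segments of `K` it is also open, so `K ⊆ cor U`: `K` itself is
weakly compact and `U` drops out. Then comes a dichotomy. If the Minty sets of points of `K` have
the KKM property, weak compactness gives them a common point in `K`. If not, some `z` in the hull of
a finite subset of `K` avoids the Minty sets of all its points, and quasimonotonicity makes `z` a
Minty solution against nearby points of `K`. Upper sign-continuity on short segments turns either
local Minty solution into a solution of (VI). Minty sets are convex, so KKM needs only Hahn–Banach
separation, not Brouwer. -/

namespace VarIneq

/-! ### Algebraic interior: eliminating `U` -/

section Core

variable {X : Type*} [NormedAddCommGroup X] [NormedSpace ℝ X]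

/-- The core of a convex set is algebraically open. -/
theorem exists_add_smul_mem_cor {U : Set X} (hU : Convex ℝ U) {c : X} (hc : c ∈ cor U) (v : X) :
    ∃ l : ℝ, 0 < l ∧ ∀ t ∈ Set.Ico (0 : ℝ) l, c + t • v ∈ cor U := by
  obtain ⟨l, hl, hlU⟩ := hc.2 v
  refine ⟨l / 2, by positivity, fun t ht => ⟨hlU t ⟨ht.1, by linarith [ht.2]⟩, fun w => ?_⟩⟩
  obtain ⟨m, hm, hmU⟩ := hc.2 w
  refine ⟨m / 2, by positivity, fun s hs => ?_⟩
  -- The target is the midpoint of `c + 2t • v` and `c + 2s • w`, hence the halved radii.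
  have h1 := hlU (2 * t) ⟨by linarith [ht.1], by linarith [ht.2]⟩
  have h2 := hmU (2 * s) ⟨by linarith [hs.1], by linarith [hs.2]⟩
  have h3 := hU h1 h2 (a := 1 / 2) (b := 1 / 2) (by norm_num) (by norm_num) (by norm_num)
  convert h3 using 1
  module

theorem IsWeaklyCompact.isClosed {A : Set X} (hA : IsWeaklyCompact A) : IsClosed A := by
  have h : IsClosed (toWeakSpace ℝ X '' A) := IsCompact.isClosed hA
  have h2 := h.preimage (toWeakSpaceCLM ℝ X).continuous
  convert h2 using 1
  ext x
  constructor
  · exact fun hx => ⟨x, hx, rfl⟩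
  · rintro ⟨y, hy, hyx⟩
    rwa [← (toWeakSpace ℝ X).injective hyx]

/-- If a convex set meets the core of a convex set in a closed set, it lies in that core. -/
theorem subset_cor_of_isClosed_inter {K U : Set X} (hK : Convex ℝ K) (hU : Convex ℝ U)
    (hne : (K ∩ cor U).Nonempty) (hcl : IsClosed (K ∩ cor U)) : K ⊆ cor U := by
  obtain ⟨c, hcK, hcU⟩ := hne
  intro x hx
  have hcont : Continuous fun t : ℝ => c + t • (x - c) := by fun_prop
  have hsub : Set.Icc (0 : ℝ) 1 ⊆ {t | c + t • (x - c) ∈ K ∩ cor U} := by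
    refine IsClosed.Icc_subset_of_forall_exists_gt
      ((hcl.preimage hcont).inter isClosed_Icc) (by simp [hcK, hcU]) ?_
    rintro t ⟨ht, ht0, ht1⟩ r (hr : t < r)
    obtain ⟨l, hl, hlU⟩ := exists_add_smul_mem_cor hU ht.2 (x - c)
    obtain ⟨d, hd, hdl⟩ := exists_between (lt_min (lt_min (sub_pos.2 hr) (sub_pos.2 ht1)) hl)
    simp only [lt_min_iff] at hdl
    refine ⟨t + d, ⟨?_, ?_⟩, by linarith, by linarith⟩
    · exact hK.add_smul_sub_mem hcK hx ⟨by linarith, by linarith⟩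
    · have := hlU d ⟨hd.le, hdl.2⟩
      rwa [add_assoc, ← add_smul] at this
  have := (hsub (Set.right_mem_Icc.2 zero_le_one)).2
  simpa using this

end Core

/-! ### Intersection theorems for closed convex sets -/

section KKM

variable {E ι : Type*} [NormedAddCommGroup E] [NormedSpace ℝ E]

/-- Klee's intersection theorem: if closed convex sets cover the convex hull of points `p i`, and
each `p i` lies in all the sets but possibly the `i`-th, then all the sets meet in that hull. -/
theorem exists_mem_convexHull_forall_mem_of_cover (s : Finset ι) (hs : s.Nonempty) :
    ∀ (C : ι → Set E) (p : ι → E), (∀ i ∈ s, Convex ℝ (C i)) → (∀ i ∈ s, IsClosed (C i)) →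
      (∀ i ∈ s, ∀ j ∈ s, j ≠ i → p i ∈ C j) →
      (∀ x ∈ convexHull ℝ (p '' s), ∃ j ∈ s, x ∈ C j) →
      ∃ x ∈ convexHull ℝ (p '' s), ∀ j ∈ s, x ∈ C j := by
  induction hs using Finset.Nonempty.cons_induction with
  | singleton a =>
    intro C p _ _ _ hcov
    have hp : p a ∈ convexHull ℝ (p '' (({a} : Finset ι) : Set ι)) :=
      subset_convexHull ℝ _ ⟨a, by simp, rfl⟩
    exact ⟨p a, hp, by simpa using hcov _ hp⟩
  | cons a s ha hs ih =>
    intro C p hconv hclosed hp hcov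
    set P := convexHull ℝ (p '' (Finset.cons a s ha : Finset ι)) with hP
    have hmem : ∀ j ∈ s, j ∈ Finset.cons a s ha := fun j hj => Finset.mem_cons_of_mem hj
    have hama : a ∈ Finset.cons a s ha := Finset.mem_cons_self a s
    have hpP : ∀ i ∈ Finset.cons a s ha, p i ∈ P := fun i hi =>
      subset_convexHull ℝ _ ⟨i, hi, rfl⟩
    have hPcpt : IsCompact P :=
      ((Finset.finite_toSet _).image p).isCompact_convexHull ℝ
    have hPconv : Convex ℝ P := convex_convexHull ℝ _
    by_contra! hcon
    set A := P ∩ ⋂ j ∈ s, C j with hA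
    have hAmem : ∀ x, x ∈ P → (∀ j ∈ s, x ∈ C j) → x ∈ A := fun x h1 h2 =>
      ⟨h1, Set.mem_iInter₂.2 h2⟩
    have hAconv : Convex ℝ A := hPconv.inter (convex_iInter₂ fun j hj => hconv j (hmem j hj))
    have hAcpt : IsCompact A :=
      hPcpt.inter_right (isClosed_biInter fun j hj => hclosed j (hmem j hj))
    have hdisj : Disjoint A (P ∩ C a) := by
      rw [Set.disjoint_left]
      rintro x ⟨hxP, hxA⟩ ⟨-, hxa⟩
      obtain ⟨j, hj, hxj⟩ := hcon x hxP
      rcases Finset.mem_cons.1 hj with rfl | hj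
      · exact hxj hxa
      · exact hxj (Set.mem_iInter₂.1 hxA j hj)
    obtain ⟨f, u, v, hfA, huv, hfB⟩ := geometric_hahn_banach_compact_closed hAconv hAcpt
      (hPconv.inter (hconv a hama)) (hPcpt.isClosed.inter (hclosed a hama)) hdisj
    have hpa : f (p a) < u := hfA _ (hAmem _ (hpP a hama) fun j hj =>
      hp a hama j (hmem j hj) (by rintro rfl; exact ha hj))
    have hpi : ∀ i ∈ s, v < f (p i) := fun i hi =>
      hfB _ ⟨hpP i (hmem i hi), hp i (hmem i hi) a hama (by rintro rfl; exact ha hi)⟩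
    -- `q i` is where the segment from `p a` to `p i` crosses the hyperplane `f = u`. There `C a` is
    -- absent from `P`, so the remaining sets cover the hull of the `q i`; induction yields a point
    -- of `A` with `f = u`, against `f < u` on `A`.
    have hq : ∀ i, ∃ q, i ∈ s → q ∈ segment ℝ (p a) (p i) ∧ f q = u := by
      intro i
      by_cases hi : i ∈ s
      · have hlt : 0 < f (p i) - f (p a) := by linarith [hpi i hi]
        set r := (u - f (p a)) / (f (p i) - f (p a)) with hr
        have hr0 : 0 ≤ r := div_nonneg (by linarith) hlt.le
        have hr1 : r ≤ 1 := (div_le_one hlt).2 (by linarith [hpi i hi])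
        refine ⟨p a + r • (p i - p a), fun _ => ⟨?_, ?_⟩⟩
        · rw [segment_eq_image']
          exact ⟨r, ⟨hr0, hr1⟩, rfl⟩
        · have : r * (f (p i) - f (p a)) = u - f (p a) := div_mul_cancel₀ _ hlt.ne'
          simp only [map_add, map_smul, map_sub, smul_eq_mul, this]
          ring
      · exact ⟨0, fun h => absurd h hi⟩
    choose q hq using hq
    have hqP : convexHull ℝ (q '' s) ⊆ P := by
      refine convexHull_min ?_ hPconv
      rintro _ ⟨i, hi, rfl⟩
      exact hPconv.segment_subset (hpP a hama) (hpP i (hmem i hi)) (hq i hi).1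
    have hqf : ∀ x ∈ convexHull ℝ (q '' s), f x = u := by
      have : convexHull ℝ (q '' s) ⊆ f ⁻¹' {u} := by
        refine convexHull_min ?_ ((convex_singleton u).linear_preimage f.toLinearMap)
        rintro _ ⟨i, hi, rfl⟩
        exact (hq i hi).2
      exact this
    obtain ⟨x, hx, hxC⟩ := ih C q (fun i hi => hconv i (hmem i hi))
      (fun i hi => hclosed i (hmem i hi))
      (fun i hi j hj hji => (hconv j (hmem j hj)).segment_subset
        (hp a hama j (hmem j hj) (by rintro rfl; exact ha hj))
        (hp i (hmem i hi) j (hmem j hj) hji) (hq i hi).1)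
      (fun x hx => by
        obtain ⟨j, hj, hxj⟩ := hcov x (hqP hx)
        rcases Finset.mem_cons.1 hj with rfl | hj
        · exact absurd (hfB x ⟨hqP hx, hxj⟩) (by linarith [hqf x hx])
        · exact ⟨j, hj, hxj⟩)
    exact absurd (hfA x (hAmem x (hqP hx) hxC)) (by linarith [hqf x hx])

/-- The Knaster–Kuratowski–Mazurkiewicz theorem for closed convex sets. -/
theorem exists_mem_convexHull_forall_mem_of_kkm (C : ι → Set E) (x : ι → E) (s : Finset ι)
    (hs : s.Nonempty) (hconv : ∀ i ∈ s, Convex ℝ (C i)) (hclosed : ∀ i ∈ s, IsClosed (C i))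
    (hkkm : ∀ t ⊆ s, ∀ z ∈ convexHull ℝ (x '' t), ∃ i ∈ t, z ∈ C i) :
    ∃ z ∈ convexHull ℝ (x '' s), ∀ i ∈ s, z ∈ C i := by
  classical
  induction s using Finset.strongInduction with
  | H s ih =>
    have hp : ∀ i, ∃ p, i ∈ s → p ∈ convexHull ℝ (x '' s) ∧ ∀ j ∈ s, j ≠ i → p ∈ C j := by
      intro i
      by_cases hi : i ∈ s
      · rcases (s.erase i).eq_empty_or_nonempty with he | hne
        · refine ⟨x i, fun _ => ⟨subset_convexHull ℝ _ ⟨i, hi, rfl⟩, fun j hj hji => ?_⟩⟩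
          exact absurd (Finset.mem_erase.2 ⟨hji, hj⟩) (by simp [he])
        · have hsub := Finset.erase_subset i s
          obtain ⟨z, hz, hzC⟩ := ih _ (Finset.erase_ssubset hi) hne
            (fun j hj => hconv j (hsub hj)) (fun j hj => hclosed j (hsub hj))
            (fun t ht => hkkm t (ht.trans hsub))
          exact ⟨z, fun _ => ⟨convexHull_mono (Set.image_mono (by exact_mod_cast hsub)) hz,
            fun j hj hji => hzC j (Finset.mem_erase.2 ⟨hji, hj⟩)⟩⟩
      · exact ⟨0, fun h => absurd h hi⟩
    choose p hp using hp
    have hsub : convexHull ℝ (p '' s) ⊆ convexHull ℝ (x '' s) := by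
      refine convexHull_min ?_ (convex_convexHull ℝ _)
      rintro _ ⟨i, hi, rfl⟩
      exact (hp i hi).1
    obtain ⟨z, hz, hzC⟩ := exists_mem_convexHull_forall_mem_of_cover s hs C p hconv hclosed
      (fun i hi => (hp i hi).2) (fun z hz => hkkm s subset_rfl z (hsub hz))
    exact ⟨z, hsub hz, hzC⟩

end KKM

/-! ### Minty sets and local Minty solutions -/

section Minty

variable {X : Type*} [NormedAddCommGroup X] [NormedSpace ℝ X]

/-- The points `x` at which the Minty inequality `⟨y*, y - x⟩ ≥ 0` holds for all `y* ∈ T y`. -/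
def mintySet (T : X → Set (StrongDual ℝ X)) (y : X) : Set X :=
  {x | ∀ ys ∈ T y, 0 ≤ ys (y - x)}

theorem mintySet_eq (T : X → Set (StrongDual ℝ X)) (y : X) :
    mintySet T y = ⋂ ys ∈ T y, {x | ys x ≤ ys y} := by
  ext x
  simp [mintySet]

theorem convex_mintySet (T : X → Set (StrongDual ℝ X)) (y : X) : Convex ℝ (mintySet T y) := by
  rw [mintySet_eq]
  exact convex_iInter₂ fun ys _ => convex_halfSpace_le ys.toLinearMap.isLinear _

theorem isClosed_mintySet (T : X → Set (StrongDual ℝ X)) (y : X) : IsClosed (mintySet T y) := by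
  rw [mintySet_eq]
  exact isClosed_biInter fun ys _ => isClosed_le ys.continuous continuous_const

/-- Mazur: norm and weak closures of a convex set agree. -/
theorem isClosed_toWeakSpace_image_mintySet (T : X → Set (StrongDual ℝ X)) (y : X) :
    IsClosed (toWeakSpace ℝ X '' mintySet T y) := by
  have h := (convex_mintySet T y).toWeakSpace_closure (𝕜 := ℝ)
  rw [(isClosed_mintySet T y).closure_eq] at h
  rw [h]
  exact isClosed_closure

/-- A local Minty solution `x` is a solution of the variational inequality. -/
theorem isSolutionVI_of_local_minty {T : X → Set (StrongDual ℝ X)} {K : Set X}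
    (hK : Convex ℝ K) {x : X} (hx : x ∈ K) (hT : LocallyUpperSignContinuousAt T x)
    (hm : ∀ᶠ y in 𝓝 x, y ∈ K → x ∈ mintySet T y) : IsSolutionVI T K x := by
  refine ⟨hx, fun y hy => ?_⟩
  obtain ⟨V, hV, hVc, Φ, hΦ, hΦV⟩ := hT
  have hcont : Filter.Tendsto (fun t : ℝ => x + t • (y - x)) (𝓝 0) (𝓝 x) := by
    have : Continuous fun t : ℝ => x + t • (y - x) := by fun_prop
    simpa using this.tendsto 0
  obtain ⟨r, hr, hball⟩ := Metric.eventually_nhds_iff.1 (hcont.eventually (hm.and hV))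
  obtain ⟨d, hd, hdr⟩ := exists_between (lt_min hr one_pos)
  have hd1 : d < 1 := hdr.trans_le (min_le_right _ _)
  have hnear : ∀ t, 0 ≤ t → t ≤ d → x + t • (y - x) ∈ K ∧ x + t • (y - x) ∈ V ∧
      x ∈ mintySet T (x + t • (y - x)) := by
    intro t ht htd
    have hb := hball (y := t) (by
      rw [Real.dist_eq, sub_zero, abs_of_nonneg ht]
      exact htd.trans_lt (hdr.trans_le (min_le_left _ _)))
    have hKt := hK.add_smul_sub_mem hx hy (t := t) ⟨ht, by linarith⟩
    exact ⟨hKt, hb.2, hb.1 hKt⟩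
  have hsup := hΦ x (mem_of_mem_nhds hV) (x + d • (y - x)) (hnear d hd.le le_rfl).2.1 (by
    intro t ht
    refine le_iInf₂ fun zs hzs => ?_
    have hpt : t • x + (1 - t) • (x + d • (y - x)) = x + ((1 - t) * d) • (y - x) := by module
    rw [hpt] at hzs
    have hpos : 0 < (1 - t) * d := mul_pos (by linarith [ht.2]) hd
    obtain ⟨-, hV', hM⟩ := hnear _ hpos.le (by nlinarith [ht.1])
    have h0 := hM zs ((hΦV _ hV').2.2.2 hzs).1
    rw [add_sub_cancel_left, map_smul, smul_eq_mul] at h0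
    rw [add_sub_cancel_left, map_smul, smul_eq_mul]
    exact_mod_cast mul_nonneg hd.le (nonneg_of_mul_nonneg_right h0 hpos))
  by_contra! hneg
  -- A real `e < 0` above the supremum keeps the bound uniform: after scaling by `d`, the supremum
  -- over `Φ x` is at most `d * e < 0`.
  obtain ⟨e, hlt, he0⟩ := EReal.lt_iff_exists_real_btwn.1 hneg
  refine absurd hsup (not_le.2 (lt_of_le_of_lt (b := ((d * e : ℝ) : EReal)) ?_ ?_))
  · refine iSup₂_le fun xs hxs => ?_
    have hxT : xs ∈ T x := ((hΦV x (mem_of_mem_nhds hV)).2.2.2 hxs).1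
    have h1 : ((xs (y - x) : ℝ) : EReal) < e :=
      (le_iSup₂ (f := fun (zs : StrongDual ℝ X) (_ : zs ∈ T x) =>
        ((zs (y - x) : ℝ) : EReal)) xs hxT).trans_lt hlt
    have h2 : xs (y - x) < e := by exact_mod_cast h1
    rw [add_sub_cancel_left, map_smul, smul_eq_mul]
    exact_mod_cast mul_le_mul_of_nonneg_left h2.le hd.le
  · have he : e < 0 := by exact_mod_cast he0
    exact_mod_cast mul_neg_of_pos_of_neg hd he

/-- A point of the convex hull of finitely many points of `K` that lies in none of their Minty sets
is a local Minty solution of a quasimonotone map. -/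
theorem QuasimonotoneOn.eventually_mem_mintySet {T : X → Set (StrongDual ℝ X)} {K : Set X}
    (hT : QuasimonotoneOn T K) {t : Finset X} (ht : (t : Set X) ⊆ K) {z : X}
    (hz : z ∈ convexHull ℝ (t : Set X)) (hzt : ∀ i ∈ t, z ∉ mintySet T i) :
    ∀ᶠ y in 𝓝 z, y ∈ K → z ∈ mintySet T y := by
  -- Failure of the Minty inequality at `z` is a strict inequality, so it persists for `y` near `z`.
  have hev : ∀ i ∈ t, ∀ᶠ y in 𝓝 z, ∃ xs ∈ T i, 0 < xs (y - i) := by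
    intro i hi
    obtain ⟨xs, hxs, hneg⟩ : ∃ xs ∈ T i, xs (i - z) < 0 := by
      simpa [mintySet] using hzt i hi
    have hpos : 0 < xs (z - i) := by
      rw [map_sub] at hneg ⊢
      linarith
    have hc : Continuous fun y => xs (y - i) := by fun_prop
    filter_upwards [hc.tendsto z |>.eventually (lt_mem_nhds hpos)] with y hy
    exact ⟨xs, hxs, hy⟩
  filter_upwards [(Filter.eventually_all_finset t).2 hev] with y hy hyK ys hys
  -- Quasimonotonicity for each pair `i, y` puts all of `t` in one half-space, which then contains
  -- `z`.
  have hsub : convexHull ℝ (t : Set X) ⊆ {w | ys w ≤ ys y} := by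
    refine convexHull_min (fun i hi => ?_) (convex_halfSpace_le ys.toLinearMap.isLinear _)
    have := hT i (ht hi) y hyK (hy i hi) ys hys
    rw [map_sub] at this
    exact sub_nonneg.1 this
  rw [map_sub]
  exact sub_nonneg.2 (hsub hz)

/-- A quasimonotone map on a nonempty convex weakly compact set has a local Minty solution. -/
theorem QuasimonotoneOn.exists_local_minty {T : X → Set (StrongDual ℝ X)} {K : Set X}
    (hT : QuasimonotoneOn T K) (hne : K.Nonempty) (hK : Convex ℝ K) (hcpt : IsWeaklyCompact K) :
    ∃ x ∈ K, ∀ᶠ y in 𝓝 x, y ∈ K → x ∈ mintySet T y := by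
  by_cases hprop : ∀ t : Finset X, (t : Set X) ⊆ K → ∀ z ∈ convexHull ℝ (t : Set X),
      ∃ i ∈ t, z ∈ mintySet T i
  · have hint := IsCompact.inter_iInter_nonempty hcpt
      (fun y : K => toWeakSpace ℝ X '' mintySet T y)
      (fun y => isClosed_toWeakSpace_image_mintySet T y) (by
        intro s
        rcases s.eq_empty_or_nonempty with rfl | hs
        · simpa using hne
        obtain ⟨z, hz, hzC⟩ := exists_mem_convexHull_forall_mem_of_kkm
          (fun y : K => mintySet T y) (fun y : K => (y : X)) s hs
          (fun i _ => convex_mintySet T i) (fun i _ => isClosed_mintySet T i) (by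
            classical
            intro t _ z hz
            obtain ⟨i, hi, hzi⟩ := hprop (t.image (fun y : K => (y : X)))
              (by intro w; simp +contextual) z (by simpa using hz)
            obtain ⟨j, hj, rfl⟩ := Finset.mem_image.1 hi
            exact ⟨j, hj, hzi⟩)
        have hzK : z ∈ K := by
          refine convexHull_min ?_ hK hz
          rintro _ ⟨y, -, rfl⟩
          exact y.2
        exact ⟨toWeakSpace ℝ X z, ⟨z, hzK, rfl⟩,
          Set.mem_iInter₂.2 fun y hy => ⟨z, hzC y hy, rfl⟩⟩)
    obtain ⟨_, ⟨x, hx, rfl⟩, hxi⟩ := hint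
    refine ⟨x, hx, Filter.Eventually.of_forall fun y hy => ?_⟩
    obtain ⟨x', hx', he⟩ := Set.mem_iInter.1 hxi ⟨y, hy⟩
    rwa [← (toWeakSpace ℝ X).injective he]
  · push Not at hprop
    obtain ⟨t, ht, z, hz, hzt⟩ := hprop
    exact ⟨z, convexHull_min ht hK hz, hT.eventually_mem_mintySet ht hz hzt⟩

end Minty

end VarIneq

theorem theorem3p7 {X : Type*} [NormedAddCommGroup X] [NormedSpace ℝ X] [CompleteSpace X]
    (K U : Set X) (hK : K.Nonempty) (hKc : Convex ℝ K) (hU : U.Nonempty) (hUc : Convex ℝ U)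
    (hne : (K ∩ VarIneq.cor U).Nonempty)
    (hcpt : VarIneq.IsWeaklyCompact (K ∩ VarIneq.cor U))
    (T : X → Set (StrongDual ℝ X))
    (hT : VarIneq.QuasimonotoneOn T K)
    (hloc : ∀ x ∈ K, VarIneq.LocallyUpperSignContinuousAt T x) :
    ∃ x : X, VarIneq.IsSolutionVI T K x := by
  have hsub := VarIneq.subset_cor_of_isClosed_inter hKc hUc hne hcpt.isClosed
  rw [Set.inter_eq_left.2 hsub] at hcpt
  obtain ⟨x, hx, hm⟩ := hT.exists_local_minty hK hKc hcpt
  exact ⟨x, VarIneq.isSolutionVI_of_local_minty hKc hx (hloc x hx) hm⟩
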